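/- Let $(X,\mathcal{B}_X,\mu)$ be a probability space and let $T=(T^{(m,n)})_{(m,n)\in\mathbb{Z}^2}$ be an action of the additive group $\mathbb{Z}^2$ on $X$ by measure-preserving measurable transformations. Write $U_T^{(m,n)}f=f\circ T^{(m,n)}$ for $f$ in the complex Hilbert space $L^2(X,\mathcal{B}_X,\mu)$, with $\langle f,g\rangle=\int_X f\overline{g}\,d\mu$. Let $\vec v=(1,\beta)\in\mathbb{R}^2$, and for $b\in(0,\infty)$ and $k\in\mathbb{N}$ put $$\Lambda^{\vec v}(b)=\{(m,n)\in\mathbb{Z}^2:\ \beta m-b/2\le n\le \beta m+b/2\},\qquad \Lambda_k^{\vec v}(b)=\Lambda^{\vec v}(b)\cap([0,k-1]\times\mathbb{Z}).$$ Let $\mathcal{K}_\mu^{\vec v}$ be the $\vec v$-directional Kronecker algebra, i.e. the sub-$\sigma$-algebra of all $B\in\mathcal{B}_X$ such that the closure of $\{U_T^{(m,n)}1_B:(m,n)\in\Lambda^{\vec v}(c)\}$ is compact in $L^2(X,\mathcal{B}_X,\mu)$, where the width $c\in(0,\infty)$ may be chosen arbitrarily, and let $$WM^{\mu,\vec v}(X)=\{f\in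 L^2(X,\mathcal{B}_X,\mu):\ \mathbb{E}(f\mid\mathcal{K}_\mu^{\vec v})=0\ \ \mu\text{-a.e.}\}$$ be the set of $\vec v$-weak mixing functions. Then, for every $b\in(0,\infty)$ and every choice of $c\in(0,\infty)$, $$WM^{\mu,\vec v}(X)=\Big\{f\in L^2(X,\mathcal{B}_X,\mu):\ \text{for all } g\in L^2(X,\mathcal{B}_X,\mu),\ \lim_{k\to\infty}\frac{1}{\#\Lambda_k^{\vec v}(b)}\sum_{(m,n)\in\Lambda_k^{\vec v}(b)}\big|\langle U_T^{(m,n)}f,g\rangle\big|=0\Big\}.$$ -/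

import Mathlib

open MeasureTheory Filter Topology

noncomputable section

namespace DirectionalWeakMixing

/-- A measure-preserving action `v ↦ T^v` of the additive group `ℤ²` on `(X, μ)`: together with a
probability measure `μ` this is a `ℤ²`-measure preserving system. -/
structure MPAction {X : Type*} [MeasurableSpace X] (μ : Measure X) where
  /-- the transformation `T^{(m,n)}` -/
  toFun : ℤ × ℤ → X → X
  map_zero : ∀ x, toFun 0 x = x
  map_add : ∀ v w x, toFun (v + w) x = toFun v (toFun w x)
  measurePreserving : ∀ v, MeasurePreserving (toFun v) μ μ

/-- The strip `Λ^v(b) = {(m,n) ∈ ℤ² : βm - b/2 ≤ n ≤ βm + b/2}` in the direction `v = (1,β)`. -/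
def strip (β b : ℝ) : Set (ℤ × ℤ) :=
  {p | β * (p.1 : ℝ) - b / 2 ≤ (p.2 : ℝ) ∧ (p.2 : ℝ) ≤ β * (p.1 : ℝ) + b / 2}

/-- `Λ^v(b) ∩ ([0,k-1] × ℤ)` as a set. -/
def truncStripSet (β b : ℝ) (k : ℕ) : Set (ℤ × ℤ) :=
  strip β b ∩ (Set.Icc (0 : ℤ) ((k : ℤ) - 1) ×ˢ Set.univ)

theorem truncStripSet_finite (β b : ℝ) (k : ℕ) : (truncStripSet β b k).Finite := by
  have h : (⋃ m ∈ Set.Icc (0 : ℤ) ((k : ℤ) - 1),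
      (fun n : ℤ => (m, n)) '' Set.Icc ⌈β * (m : ℝ) - b / 2⌉ ⌊β * (m : ℝ) + b / 2⌋).Finite :=
    (Set.finite_Icc _ _).biUnion fun m _ => (Set.finite_Icc _ _).image _
  refine h.subset ?_
  rintro ⟨m, n⟩ ⟨⟨h1, h2⟩, hm, -⟩
  simp only [Set.mem_iUnion]
  exact ⟨m, hm, n, ⟨Int.ceil_le.2 h1, Int.le_floor.2 h2⟩, rfl⟩

/-- `Λ_k^v(b) = Λ^v(b) ∩ ([0,k-1] × ℤ)` as a finite set. -/
def truncStrip (β b : ℝ) (k : ℕ) : Finset (ℤ × ℤ) := (truncStripSet_finite β b k).toFinset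

section System

variable {X : Type*} [MeasurableSpace X] {μ : Measure X}

/-- The Koopman operator `U_T^{(m,n)} f = f ∘ T^{(m,n)}` on the complex space `L²(X, μ)`. -/
def koopman (T : MPAction μ) (v : ℤ × ℤ) (f : Lp ℂ 2 μ) : Lp ℂ 2 μ :=
  Lp.compMeasurePreserving (T.toFun v) (T.measurePreserving v) f

/-- The measurable set `B` has a relatively compact orbit
`{U_T^{(m,n)} 1_B : (m,n) ∈ Λ^v(b)}` in `L²(X, μ)`. -/
def IsKroneckerSet [IsFiniteMeasure μ] (T : MPAction μ) (β b : ℝ) (B : Set X) : Prop :=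
  ∃ hB : MeasurableSet B, IsCompact (closure
    ((fun v => koopman T v (indicatorConstLp 2 hB (measure_ne_top μ B) (1 : ℂ))) '' strip β b))

/-- The pseudo-distance between `U_T^v 1_B` and `U_T^w 1_B`. -/
theorem dist_koopman_indicator [IsFiniteMeasure μ] (T : MPAction μ) {B : Set X}
    (hB : MeasurableSet B) (v w : ℤ × ℤ) :
    dist (koopman T v (indicatorConstLp 2 hB (measure_ne_top μ B) (1 : ℂ)))
      (koopman T w (indicatorConstLp 2 hB (measure_ne_top μ B) (1 : ℂ)))
      = Real.sqrt (μ.real (symmDiff (T.toFun v ⁻¹' B) (T.toFun w ⁻¹' B))) := by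
  unfold koopman
  rw [Lp.indicatorConstLp_compMeasurePreserving, Lp.indicatorConstLp_compMeasurePreserving,
    dist_indicatorConstLp_eq_norm, norm_indicatorConstLp (by simp) (by simp),
    Real.sqrt_eq_rpow]
  simp

theorem isKroneckerSet_iff [IsFiniteMeasure μ] (T : MPAction μ) (β b : ℝ) (B : Set X) :
    IsKroneckerSet T β b B ↔ MeasurableSet B ∧ ∀ ε > 0, ∃ t : Set (ℤ × ℤ), t.Finite ∧
      ∀ v ∈ strip β b, ∃ w ∈ t,
        μ.real (symmDiff (T.toFun v ⁻¹' B) (T.toFun w ⁻¹' B)) < ε := by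
  constructor
  · rintro ⟨hB, hc⟩
    refine ⟨hB, fun ε hε => ?_⟩
    have htb := hc.totallyBounded.subset subset_closure
    obtain ⟨s, hs, hfin, hcov⟩ :=
      Metric.finite_approx_of_totallyBounded htb (Real.sqrt ε) (Real.sqrt_pos.2 hε)
    obtain ⟨t, -, htfin, rfl⟩ := (Set.exists_subset_image_finite_and
      (p := fun u => u = s)).1 ⟨s, hs, hfin, rfl⟩
    refine ⟨t, htfin, fun v hv => ?_⟩
    have := hcov (Set.mem_image_of_mem _ hv)
    simp only [Set.mem_iUnion, Metric.mem_ball] at this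
    obtain ⟨y, ⟨w, hw, rfl⟩, hy⟩ := this
    refine ⟨w, hw, ?_⟩
    rw [dist_koopman_indicator T hB] at hy
    exact (Real.sqrt_lt_sqrt_iff measureReal_nonneg).1 hy
  · rintro ⟨hB, h⟩
    refine ⟨hB, ?_⟩
    refine TotallyBounded.isCompact_of_isClosed (TotallyBounded.closure ?_) isClosed_closure
    rw [Metric.totallyBounded_iff]
    intro ε hε
    obtain ⟨t, htfin, ht⟩ := h (ε ^ 2) (by positivity)
    refine ⟨_, htfin.image
      (fun v => koopman T v (indicatorConstLp 2 hB (measure_ne_top μ B) (1 : ℂ))), ?_⟩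
    rintro _ ⟨v, hv, rfl⟩
    obtain ⟨w, hw, hlt⟩ := ht v hv
    simp only [Set.mem_iUnion, Metric.mem_ball]
    refine ⟨_, ⟨w, hw, rfl⟩, ?_⟩
    rw [dist_koopman_indicator T hB]
    exact (Real.sqrt_lt' hε).2 hlt

theorem IsKroneckerSet.compl [IsFiniteMeasure μ] {T : MPAction μ} {β b : ℝ} {B : Set X}
    (h : IsKroneckerSet T β b B) : IsKroneckerSet T β b Bᶜ := by
  rw [isKroneckerSet_iff] at h ⊢
  refine ⟨h.1.compl, fun ε hε => ?_⟩
  obtain ⟨t, ht, hc⟩ := h.2 ε hε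
  refine ⟨t, ht, fun v hv => ?_⟩
  obtain ⟨w, hw, hlt⟩ := hc v hv
  refine ⟨w, hw, ?_⟩
  rwa [Set.preimage_compl, Set.preimage_compl, compl_symmDiff_compl]

theorem IsKroneckerSet.union [IsFiniteMeasure μ] {T : MPAction μ} {β b : ℝ} {A B : Set X}
    (hA : IsKroneckerSet T β b A) (hB : IsKroneckerSet T β b B) :
    IsKroneckerSet T β b (A ∪ B) := by
  obtain ⟨hAm, hAc⟩ := hA
  obtain ⟨hBm, hBc⟩ := hB
  refine (isKroneckerSet_iff T β b _).2 ⟨hAm.union hBm, fun ε hε => ?_⟩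
  set gA := fun v => koopman T v (indicatorConstLp 2 hAm (measure_ne_top μ A) (1 : ℂ))
  set gB := fun v => koopman T v (indicatorConstLp 2 hBm (measure_ne_top μ B) (1 : ℂ))
  have htb : TotallyBounded ((fun v => (gA v, gB v)) '' strip β b) := by
    refine (hAc.prod hBc).totallyBounded.subset ?_
    rintro _ ⟨v, hv, rfl⟩
    exact ⟨subset_closure ⟨v, hv, rfl⟩, subset_closure ⟨v, hv, rfl⟩⟩
  have hε' : 0 < ε / 2 := by positivity
  obtain ⟨s, hs, hfin, hcov⟩ :=
    Metric.finite_approx_of_totallyBounded htb (Real.sqrt (ε / 2)) (Real.sqrt_pos.2 hε')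
  obtain ⟨t, -, htfin, rfl⟩ := (Set.exists_subset_image_finite_and
      (p := fun u => u = s)).1 ⟨s, hs, hfin, rfl⟩
  refine ⟨t, htfin, fun v hv => ?_⟩
  have := hcov (Set.mem_image_of_mem _ hv)
  simp only [Set.mem_iUnion, Metric.mem_ball] at this
  obtain ⟨y, ⟨w, hw, rfl⟩, hy⟩ := this
  refine ⟨w, hw, ?_⟩
  rw [Prod.dist_eq, max_lt_iff] at hy
  obtain ⟨h1, h2⟩ := hy
  replace h1 : dist (gA v) (gA w) < _ := h1
  replace h2 : dist (gB v) (gB w) < _ := h2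
  rw [dist_koopman_indicator T hAm, Real.sqrt_lt_sqrt_iff measureReal_nonneg] at h1
  rw [dist_koopman_indicator T hBm, Real.sqrt_lt_sqrt_iff measureReal_nonneg] at h2
  have hsub : symmDiff (T.toFun v ⁻¹' (A ∪ B)) (T.toFun w ⁻¹' (A ∪ B)) ⊆
      symmDiff (T.toFun v ⁻¹' A) (T.toFun w ⁻¹' A) ∪
        symmDiff (T.toFun v ⁻¹' B) (T.toFun w ⁻¹' B) := by
    intro x
    simp only [Set.mem_symmDiff, Set.mem_preimage, Set.mem_union]
    tauto
  have h3 := measureReal_mono (μ := μ) hsub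
  have h4 := measureReal_union_le (μ := μ) (symmDiff (T.toFun v ⁻¹' A) (T.toFun w ⁻¹' A))
    (symmDiff (T.toFun v ⁻¹' B) (T.toFun w ⁻¹' B))
  linarith

theorem IsKroneckerSet.empty [IsFiniteMeasure μ] (T : MPAction μ) (β b : ℝ) :
    IsKroneckerSet T β b (∅ : Set X) := by
  refine (isKroneckerSet_iff T β b _).2
    ⟨MeasurableSet.empty, fun ε hε => ⟨{0}, Set.finite_singleton _, fun v _ => ⟨0, rfl, ?_⟩⟩⟩
  simpa using hε

theorem IsKroneckerSet.iUnion [IsFiniteMeasure μ] {T : MPAction μ} {β b : ℝ} {B : ℕ → Set X}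
    (h : ∀ i, IsKroneckerSet T β b (B i)) : IsKroneckerSet T β b (⋃ i, B i) := by
  have hacc : ∀ n, IsKroneckerSet T β b (Set.accumulate B n) := by
    intro n
    induction n with
    | zero => simpa [Set.accumulate_zero_nat] using h 0
    | succ n ih => rw [Set.accumulate_succ]; exact ih.union (h (n + 1))
  have hm : MeasurableSet (⋃ i, B i) := MeasurableSet.iUnion fun i => (h i).1
  refine (isKroneckerSet_iff T β b _).2 ⟨hm, fun ε hε => ?_⟩
  have hlim : Tendsto (fun n => μ.real (Set.accumulate B n)) atTop (𝓝 (μ.real (⋃ i, B i))) :=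
    (ENNReal.tendsto_toReal (measure_ne_top _ _)).comp tendsto_measure_iUnion_accumulate
  obtain ⟨n, hn⟩ := ((tendsto_order.1 hlim).1 (μ.real (⋃ i, B i) - ε / 3) (by linarith)).exists
  have hnm := (hacc n).1
  have hnsub : Set.accumulate B n ⊆ ⋃ i, B i := Set.accumulate_subset_iUnion n
  have hR : μ.real ((⋃ i, B i) \ Set.accumulate B n) < ε / 3 := by
    rw [measureReal_sdiff hnsub hnm]
    linarith
  have hRm : MeasurableSet ((⋃ i, B i) \ Set.accumulate B n) := hm.diff hnm
  obtain ⟨t, ht, hc⟩ := ((isKroneckerSet_iff T β b _).1 (hacc n)).2 (ε / 3) (by linarith)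
  refine ⟨t, ht, fun v hv => ?_⟩
  obtain ⟨w, hw, hlt⟩ := hc v hv
  refine ⟨w, hw, ?_⟩
  set U := ⋃ i, B i
  set A := Set.accumulate B n
  have hpre : ∀ v, μ.real (T.toFun v ⁻¹' (U \ A)) = μ.real (U \ A) := fun v =>
    (T.measurePreserving v).measureReal_preimage hRm.nullMeasurableSet
  have hsub : symmDiff (T.toFun v ⁻¹' U) (T.toFun w ⁻¹' U) ⊆
      symmDiff (T.toFun v ⁻¹' A) (T.toFun w ⁻¹' A) ∪
        (T.toFun v ⁻¹' (U \ A) ∪ T.toFun w ⁻¹' (U \ A)) := by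
    intro x
    have h1 := @hnsub (T.toFun v x)
    have h2 := @hnsub (T.toFun w x)
    simp only [Set.mem_symmDiff, Set.mem_preimage, Set.mem_union, Set.mem_sdiff]
    tauto
  have h3 := measureReal_mono (μ := μ) hsub
  have h4 := measureReal_union_le (μ := μ) (symmDiff (T.toFun v ⁻¹' A) (T.toFun w ⁻¹' A))
    (T.toFun v ⁻¹' (U \ A) ∪ T.toFun w ⁻¹' (U \ A))
  have h5 := measureReal_union_le (μ := μ) (T.toFun v ⁻¹' (U \ A)) (T.toFun w ⁻¹' (U \ A))
  rw [hpre, hpre] at h5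
  linarith

/-- The directional Kronecker algebra: the `σ`-algebra of all measurable sets `B` such that the
closure of `{U_T^{(m,n)} 1_B : (m,n) ∈ Λ^v(b)}` is compact in `L²(X, μ)`. -/
@[reducible] def kroneckerAlgebra [IsFiniteMeasure μ] (T : MPAction μ) (β b : ℝ) : MeasurableSpace X where
  MeasurableSet' := IsKroneckerSet T β b
  measurableSet_empty := IsKroneckerSet.empty T β b
  measurableSet_compl _ h := h.compl
  measurableSet_iUnion _ h := IsKroneckerSet.iUnion h

/-- It is a sub-`σ`-algebra, so that conditional expectations on it are the genuine ones. -/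
theorem kroneckerAlgebra_le {X : Type*} [m0 : MeasurableSpace X] {μ : Measure X}
    [IsFiniteMeasure μ] (T : MPAction μ) (β b : ℝ) : kroneckerAlgebra T β b ≤ m0 :=
  fun _ h => h.1

/-- The set `WM^{μ,v}(X)` of directionally weak mixing functions: those `f ∈ L²(X, μ)` whose
conditional expectation on the directional Kronecker algebra vanishes almost everywhere. -/
def weakMixingFunctions [IsFiniteMeasure μ] (T : MPAction μ) (β b : ℝ) : Set (Lp ℂ 2 μ) :=
  {f | μ[f | kroneckerAlgebra T β b] =ᵐ[μ] 0}

end System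

end DirectionalWeakMixing

end

/-! Call a vector almost periodic if its orbit over a strip is totally bounded. Strips of different
widths are covered by finitely many translates of one another, so the notion does not depend on the
width (`AlmostPeriodic.of_strip`). Both sides of the theorem describe the orthogonal complement of
the almost periodic functions.

For the Kronecker side (`mem_weakMixingFunctions_iff`), indicators of Kronecker sets are almost
periodic by definition; conversely, Lipschitz functions of an almost periodic function are almost
periodic, which makes it measurable for the Kronecker algebra.

If the averages of `f` vanish and `g` is almost periodic, then `⟪g, f⟫ = ⟪U^v g, U^v f⟫`, and `U^v
g` may be replaced by a member of a finite net; averaging over `v` gives `⟪g, f⟫ = 0`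
(`inner_eq_zero_of_tendsto_average`).

Conversely, let `f` be orthogonal to the almost periodic vectors. Average the rank-one operators `x
↦ ⟪U^v f, x⟫ U^v f` over the strip, along an ultrafilter so that limits exist. The strip is not
invariant under translation by its points, so each point is weighted by a tent function of its
transverse coordinate, centred at `δ`. The resulting operators `K_δ` are positive with bounded
trace, hence compact; they depend Lipschitz-continuously on `δ`, and `U^w K_δ = K_{δ + offset w}
U^w`. Hence the orbit of `K_0 x` over a strip lies in a totally bounded set, so `K_0 x` is almost
periodic and orthogonal to every `U^v f`. This forces `K_0 = 0`, so the averages of `‖⟪g, U^v f⟫‖ ^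
2` vanish, and Cauchy–Schwarz removes the square. -/

noncomputable section
namespace DirectionalWeakMixing

/-! ### Lattice points in strips -/

/-- The transverse coordinate of a lattice point with respect to the direction `(1, β)`. -/
def offset (β : ℝ) (v : ℤ × ℤ) : ℝ := (v.2 : ℝ) - β * (v.1 : ℝ)

theorem offset_add (β : ℝ) (v w : ℤ × ℤ) : offset β (v + w) = offset β v + offset β w := by
  simp only [offset, Prod.fst_add, Prod.snd_add, Int.cast_add]; ring

theorem offset_sub (β : ℝ) (v w : ℤ × ℤ) : offset β (v - w) = offset β v - offset β w := by
  simp only [offset, Prod.fst_sub, Prod.snd_sub, Int.cast_sub]; ring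

theorem mem_strip_iff {β b : ℝ} {v : ℤ × ℤ} : v ∈ strip β b ↔ |offset β v| ≤ b / 2 := by
  simp only [strip, Set.mem_ofPred_eq, offset, abs_le]
  constructor <;> rintro ⟨h1, h2⟩ <;> constructor <;> linarith

theorem mem_truncStrip {β b : ℝ} {k : ℕ} {v : ℤ × ℤ} :
    v ∈ truncStrip β b k ↔ |offset β v| ≤ b / 2 ∧ 0 ≤ v.1 ∧ v.1 < k := by
  simp only [truncStrip, Set.Finite.mem_toFinset, truncStripSet, Set.mem_inter_iff, mem_strip_iff,
    Set.mem_prod, Set.mem_univ, and_true, Set.mem_Icc]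
  constructor <;> rintro ⟨h1, h2, h3⟩ <;> refine ⟨h1, h2, ?_⟩ <;> omega

/-- Finitely many translates of a strip cover any parallel strip. -/
theorem exists_finite_translates (β : ℝ) {b : ℝ} (hb : 0 < b) (c : ℝ) :
    ∃ F : Finset (ℤ × ℤ), ∀ v ∈ strip β c, ∃ w ∈ F, v - w ∈ strip β b := by
  -- The offsets of the points of the strip lie in a bounded interval; lattice points whose offsets
  -- form a finite `b / 2`-net serve as translations.
  have htb : TotallyBounded (offset β '' strip β c) :=
    (isCompact_Icc (a := -(c / 2)) (b := c / 2)).totallyBounded.subset (by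
      rintro _ ⟨v, hv, rfl⟩
      exact abs_le.1 (mem_strip_iff.1 hv))
  obtain ⟨s, hs, hfin, hcov⟩ := Metric.finite_approx_of_totallyBounded htb (b / 2) (by positivity)
  obtain ⟨t, -, htfin, rfl⟩ := (Set.exists_subset_image_finite_and
      (p := fun u => u = s)).1 ⟨s, hs, hfin, rfl⟩
  refine ⟨htfin.toFinset, fun v hv => ?_⟩
  have := hcov (Set.mem_image_of_mem _ hv)
  simp only [Set.mem_iUnion, Metric.mem_ball] at this
  obtain ⟨y, ⟨w, hw, rfl⟩, hy⟩ := this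
  refine ⟨w, by simpa using hw, mem_strip_iff.2 ?_⟩
  rw [offset_sub]
  exact hy.le

/-- A truncated strip has a number of points at least proportional to its length. -/
theorem exists_le_mul_card_truncStrip (β : ℝ) {b : ℝ} (hb : 0 < b) :
    ∃ N C : ℕ, ∀ k : ℕ, k ≤ N * (truncStrip β b k).card + C := by
  obtain ⟨F, hF⟩ := exists_finite_translates β hb 1
  obtain ⟨M, hM⟩ : ∃ M : ℕ, ∀ w ∈ F, |w.1| ≤ M := by
    refine ⟨F.sup fun w => w.1.natAbs, fun w hw => ?_⟩
    have := Finset.le_sup (f := fun w : ℤ × ℤ => w.1.natAbs) hw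
    rw [Int.abs_eq_natAbs]
    exact_mod_cast this
  -- Rounding `β * m` leaves an offset of at most `1 / 2`, so every column meets the strip of width
  -- `1`, even when the strip of width `b` misses it.
  have hcol : ∀ m : ℕ, ∃ w ∈ F, ((m : ℤ), round (β * m)) - w ∈ strip β b := fun m => by
    refine hF _ (mem_strip_iff.2 ?_)
    simp only [offset]
    rw [abs_sub_comm]
    simpa using abs_sub_round (β * m)
  choose w hwF hw using hcol
  refine ⟨F.card, 2 * M, fun k => ?_⟩
  -- Discarding `M` columns at each end keeps the translated points inside the truncation.
  have hcard := Finset.card_le_card_of_injOn (s := Finset.Ico M (k - M))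
    (t := F ×ˢ truncStrip β b k)
    (fun m => (w m, ((m : ℤ), round (β * m)) - w m)) (by
      intro m hm
      have hm' := Finset.mem_Ico.1 hm
      have h1 := abs_le.1 (hM _ (hwF m))
      refine Finset.mem_coe.2 (Finset.mem_product.2
        ⟨hwF m, mem_truncStrip.2 ⟨mem_strip_iff.1 (hw m), ?_, ?_⟩⟩)
      · simp only [Prod.fst_sub]; omega
      · simp only [Prod.fst_sub]; omega) (by
      intro m _ m' _ h
      simp only [Prod.mk.injEq] at h
      have h2 := congrArg Prod.fst h.2
      rw [h.1] at h2
      simp only [Prod.fst_sub] at h2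
      omega)
  rw [Nat.card_Ico, Finset.card_product] at hcard
  omega

theorem truncStrip_card_pos {β b : ℝ} (hb : 0 < b) {k : ℕ} (hk : 0 < k) :
    0 < (truncStrip β b k).card :=
  Finset.card_pos.2 ⟨0, mem_truncStrip.2 ⟨by simp [offset]; positivity, by simp, by simpa⟩⟩

theorem totallyBounded_of_forall_approx {α : Type*} [PseudoMetricSpace α] {s : Set α}
    (h : ∀ ε > 0, ∃ t : Set α, TotallyBounded t ∧ ∀ x ∈ s, ∃ y ∈ t, dist x y < ε) :
    TotallyBounded s := by
  rw [Metric.totallyBounded_iff]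
  intro ε hε
  obtain ⟨t, ht, hst⟩ := h (ε / 2) (by positivity)
  obtain ⟨u, hu, htu⟩ := Metric.totallyBounded_iff.1 ht (ε / 2) (by positivity)
  refine ⟨u, hu, fun x hx => ?_⟩
  obtain ⟨y, hy, hxy⟩ := hst x hx
  have := htu hy
  simp only [Set.mem_iUnion, Metric.mem_ball] at this ⊢
  obtain ⟨z, hz, hyz⟩ := this
  exact ⟨z, hz, by linarith [dist_triangle x y z]⟩

/-! ### Shift-invariant means along an ultrafilter -/

section Mean

/-- The Cesàro averages of a function on `ℤ` along `0, …, k - 1`. -/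
def cesaro (a : ℤ → ℂ) (k : ℕ) : ℂ := (k : ℂ)⁻¹ * ∑ m ∈ Finset.range k, a m

theorem norm_cesaro_le {a : ℤ → ℂ} {M : ℝ} (ha : ∀ m, ‖a m‖ ≤ M) (k : ℕ) : ‖cesaro a k‖ ≤ M := by
  have hM : 0 ≤ M := (norm_nonneg _).trans (ha 0)
  rcases Nat.eq_zero_or_pos k with rfl | hk
  · simpa [cesaro] using hM
  rw [cesaro, norm_mul, norm_inv, Complex.norm_natCast, inv_mul_le_iff₀ (by positivity)]
  refine (norm_sum_le _ _).trans ?_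
  simpa using Finset.sum_le_card_nsmul (Finset.range k) (fun m => ‖a m‖) M fun m _ => ha m

/-- The limit of the Cesàro averages along a filter, meaningful for bounded functions and
ultrafilters. -/
def ultraMean (𝒰 : Ultrafilter ℕ) (a : ℤ → ℂ) : ℂ := limUnder (𝒰 : Filter ℕ) (cesaro a)

variable {𝒰 : Ultrafilter ℕ} {a a' : ℤ → ℂ} {M : ℝ}

theorem tendsto_ultraMean (𝒰 : Ultrafilter ℕ) (ha : ∀ m, ‖a m‖ ≤ M) :
    Tendsto (cesaro a) 𝒰 (𝓝 (ultraMean 𝒰 a)) := by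
  refine tendsto_nhds_limUnder ?_
  have hc := isCompact_closedBall (0 : ℂ) M
  obtain ⟨z, -, hz⟩ := hc.ultrafilter_le_nhds' (𝒰.map (cesaro a))
    (Ultrafilter.mem_map.2 (Filter.univ_mem' fun k => by simpa using norm_cesaro_le ha k))
  exact ⟨z, hz⟩

theorem norm_ultraMean_le (ha : ∀ m, ‖a m‖ ≤ M) : ‖ultraMean 𝒰 a‖ ≤ M :=
  le_of_tendsto (tendsto_ultraMean 𝒰 ha).norm (Eventually.of_forall (norm_cesaro_le ha))

theorem norm_ultraMean_sub_le {M₁ M₂ : ℝ} (ha : ∀ m, ‖a m‖ ≤ M₁) (ha' : ∀ m, ‖a' m‖ ≤ M₂)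
    (h : ∀ m, ‖a m - a' m‖ ≤ M) : ‖ultraMean 𝒰 a - ultraMean 𝒰 a'‖ ≤ M := by
  refine le_of_tendsto ((tendsto_ultraMean 𝒰 ha).sub (tendsto_ultraMean 𝒰 ha')).norm
    (Eventually.of_forall fun k => ?_)
  have := norm_cesaro_le h k
  simpa only [cesaro, Finset.sum_sub_distrib, mul_sub] using this

theorem ultraMean_add {M' : ℝ} (ha : ∀ m, ‖a m‖ ≤ M) (ha' : ∀ m, ‖a' m‖ ≤ M') :
    ultraMean 𝒰 (fun m => a m + a' m) = ultraMean 𝒰 a + ultraMean 𝒰 a' := by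
  have h : ∀ m, ‖a m + a' m‖ ≤ M + M' := fun m =>
    (norm_add_le _ _).trans (add_le_add (ha m) (ha' m))
  refine tendsto_nhds_unique (tendsto_ultraMean 𝒰 h) ?_
  refine ((tendsto_ultraMean 𝒰 ha).add (tendsto_ultraMean 𝒰 ha')).congr fun k => ?_
  simp only [cesaro, Finset.sum_add_distrib, mul_add]

theorem ultraMean_const_mul (z : ℂ) (ha : ∀ m, ‖a m‖ ≤ M) :
    ultraMean 𝒰 (fun m => z * a m) = z * ultraMean 𝒰 a := by
  have h : ∀ m, ‖z * a m‖ ≤ ‖z‖ * M := fun m => by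
    rw [norm_mul]; exact mul_le_mul_of_nonneg_left (ha m) (norm_nonneg _)
  refine tendsto_nhds_unique (tendsto_ultraMean 𝒰 h) ?_
  refine ((tendsto_ultraMean 𝒰 ha).const_mul z).congr fun k => ?_
  simp only [cesaro, ← Finset.mul_sum]; ring

/-- The two Cesàro sums differ only by boundary terms, which are bounded and hence negligible after
division by `k`. -/
theorem ultraMean_add_one (h𝒰 : (𝒰 : Filter ℕ) ≤ atTop) (ha : ∀ m, ‖a m‖ ≤ M) :
    ultraMean 𝒰 (fun m => a (m + 1)) = ultraMean 𝒰 a := by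
  have h0 : Tendsto (fun k : ℕ => (k : ℂ)⁻¹ * (a k - a 0)) 𝒰 (𝓝 0) := by
    refine (squeeze_zero_norm (a := fun k : ℕ => (k : ℝ)⁻¹ * (2 * M)) (fun k => ?_) ?_).mono_left h𝒰
    · rw [norm_mul, norm_inv, Complex.norm_natCast]
      refine mul_le_mul_of_nonneg_left ((norm_sub_le _ _).trans ?_) (by positivity)
      linarith [ha k, ha 0]
    · simpa using (tendsto_inv_atTop_nhds_zero_nat (𝕜 := ℝ)).mul_const (2 * M)
  refine tendsto_nhds_unique (tendsto_ultraMean 𝒰 fun m => ha (m + 1)) ?_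
  have := (tendsto_ultraMean 𝒰 ha).add h0
  rw [add_zero] at this
  refine this.congr fun k => ?_
  have h1 := Finset.sum_range_succ (fun m : ℕ => a m) k
  have h2 := Finset.sum_range_succ' (fun m : ℕ => a m) k
  push_cast at h2
  simp only [cesaro]
  rw [← mul_add]
  congr 1
  rw [h1] at h2
  linear_combination h2

theorem ultraMean_shift (h𝒰 : (𝒰 : Filter ℕ) ≤ atTop) (ha : ∀ m, ‖a m‖ ≤ M) (l : ℤ) :
    ultraMean 𝒰 (fun m => a (m + l)) = ultraMean 𝒰 a := by
  induction l with
  | zero => simp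
  | succ l ih =>
    rw [← ih, ← ultraMean_add_one h𝒰 (a := fun m => a (m + l)) fun m => ha _]
    congr 1; ext m; congr 1; ring
  | pred l ih =>
    rw [← ih, ← ultraMean_add_one h𝒰 (a := fun m => a (m + (-(l : ℤ) - 1))) fun m => ha _]
    congr 1; ext m; congr 1; ring

end Mean

/-! ### Tent-weighted sums over columns -/

section Window

open scoped ComplexOrder

/-- The tent function of half-width `B`. -/
def tent (B s : ℝ) : ℝ := max 0 (B - |s|)

theorem tent_nonneg (B s : ℝ) : 0 ≤ tent B s := le_max_left _ _

theorem tent_le {B : ℝ} (hB : 0 ≤ B) (s : ℝ) : tent B s ≤ B :=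
  max_le hB (by linarith [abs_nonneg s])

theorem tent_eq_zero {B s : ℝ} (h : B ≤ |s|) : tent B s = 0 := max_eq_left (by linarith)

/-- This Lipschitz bound is the reason for tents instead of sharp cut-offs: it makes the mean
operators continuous in the centre `δ`. -/
theorem abs_tent_sub_le (B s t : ℝ) : |tent B s - tent B t| ≤ |s - t| := by
  unfold tent
  refine (abs_max_sub_max_le_max _ _ _ _).trans ?_
  have : |(B - |s|) - (B - |t|)| ≤ |s - t| := by
    rw [abs_sub_comm s t, sub_sub_sub_cancel_left]
    exact abs_abs_sub_abs_le t s
  simpa using this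

/-- The sum of `F` over the column of abscissa `m`, weighted by a tent centred at the height
where the transverse coordinate is `δ`. -/
def columnSum (β B δ : ℝ) (F : ℤ × ℤ → ℂ) (m : ℤ) : ℂ :=
  ∑' n : ℤ, (tent B (offset β (m, n) - δ) : ℂ) * F (m, n)

/-- A finite set of heights carrying all the weights of the column of abscissa `m`. -/
def columnSupport (β R : ℝ) (m : ℤ) : Finset ℤ :=
  Finset.Icc ⌈β * (m : ℝ) - R⌉ ⌊β * (m : ℝ) + R⌋

theorem mem_columnSupport {β R : ℝ} {m n : ℤ} :
    n ∈ columnSupport β R m ↔ |offset β (m, n)| ≤ R := by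
  rw [columnSupport, Finset.mem_Icc, Int.ceil_le, Int.le_floor, abs_le, offset]
  constructor <;> rintro ⟨h1, h2⟩ <;> constructor <;> linarith

theorem card_columnSupport_le (β : ℝ) {R : ℝ} (hR : 0 ≤ R) (m : ℤ) :
    ((columnSupport β R m).card : ℝ) ≤ 2 * R + 1 := by
  rw [columnSupport, Int.card_Icc]
  have h1 := Int.floor_le (β * (m : ℝ) + R)
  have h2 := Int.le_ceil (β * (m : ℝ) - R)
  rcases le_total 0 (⌊β * (m : ℝ) + R⌋ + 1 - ⌈β * (m : ℝ) - R⌉) with h | h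
  · have : (((⌊β * (m : ℝ) + R⌋ + 1 - ⌈β * (m : ℝ) - R⌉).toNat : ℤ) : ℝ) ≤ 2 * R + 1 := by
      rw [Int.toNat_of_nonneg h]; push_cast; linarith
    exact_mod_cast this
  · rw [Int.toNat_of_nonpos h]; push_cast; linarith

variable {β B D δ δ' : ℝ} {F G : ℤ × ℤ → ℂ}

theorem columnSum_eq_sum (hδ : |δ| ≤ D) (F : ℤ × ℤ → ℂ) (m : ℤ) :
    columnSum β B δ F m =
      ∑ n ∈ columnSupport β (B + D) m, (tent B (offset β (m, n) - δ) : ℂ) * F (m, n) := by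
  refine tsum_eq_sum fun n hn => ?_
  rw [mem_columnSupport, not_le] at hn
  rw [tent_eq_zero]
  · simp
  · have := abs_sub_abs_le_abs_sub (offset β (m, n)) δ
    linarith

theorem norm_columnSum_le (hB : 0 ≤ B) (hδ : |δ| ≤ D) {M : ℝ} (hF : ∀ v, ‖F v‖ ≤ M) (m : ℤ) :
    ‖columnSum β B δ F m‖ ≤ (2 * (B + D) + 1) * (B * M) := by
  have hM : 0 ≤ M := (norm_nonneg _).trans (hF 0)
  have hD : 0 ≤ D := (abs_nonneg _).trans hδ
  rw [columnSum_eq_sum hδ]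
  refine (norm_sum_le _ _).trans ((Finset.sum_le_card_nsmul _ _ (B * M) fun n _ => ?_).trans ?_)
  · rw [norm_mul, Complex.norm_real, Real.norm_of_nonneg (tent_nonneg _ _)]
    exact mul_le_mul (tent_le hB _) (hF _) (norm_nonneg _) hB
  · rw [nsmul_eq_mul]
    exact mul_le_mul_of_nonneg_right (card_columnSupport_le β (by positivity) m) (by positivity)

theorem norm_columnSum_sub_le (hB : 0 ≤ B) (hδ : |δ| ≤ D) (hδ' : |δ'| ≤ D) {M : ℝ}
    (hF : ∀ v, ‖F v‖ ≤ M) (m : ℤ) :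
    ‖columnSum β B δ F m - columnSum β B δ' F m‖ ≤ (2 * (B + D) + 1) * (|δ - δ'| * M) := by
  have hM : 0 ≤ M := (norm_nonneg _).trans (hF 0)
  have hD : 0 ≤ D := (abs_nonneg _).trans hδ
  rw [columnSum_eq_sum hδ, columnSum_eq_sum hδ', ← Finset.sum_sub_distrib]
  refine (norm_sum_le _ _).trans
    ((Finset.sum_le_card_nsmul _ _ (|δ - δ'| * M) fun n _ => ?_).trans ?_)
  · rw [← sub_mul, norm_mul, ← Complex.ofReal_sub, Complex.norm_real, Real.norm_eq_abs]
    refine mul_le_mul ((abs_tent_sub_le _ _ _).trans_eq ?_) (hF _) (norm_nonneg _) (abs_nonneg _)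
    rw [abs_sub_comm]; congr 1; ring
  · rw [nsmul_eq_mul]
    exact mul_le_mul_of_nonneg_right (card_columnSupport_le β (by positivity) m) (by positivity)

theorem columnSum_add (m : ℤ) :
    columnSum β B δ (fun v => F v + G v) m = columnSum β B δ F m + columnSum β B δ G m := by
  simp only [columnSum_eq_sum le_rfl, ← Finset.sum_add_distrib, mul_add]

theorem columnSum_const_mul (z : ℂ) (m : ℤ) :
    columnSum β B δ (fun v => z * F v) m = z * columnSum β B δ F m := by
  simp only [columnSum_eq_sum le_rfl, Finset.mul_sum]
  exact Finset.sum_congr rfl fun n _ => by ring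

/-- Translation by `w` permutes columns and moves the centre of the tent by `offset β w`; summing
over all of `ℤ` makes this a plain reindexing. -/
theorem columnSum_shift (w : ℤ × ℤ) (m : ℤ) :
    columnSum β B δ (fun v => F (v + w)) m = columnSum β B (δ + offset β w) F (m + w.1) := by
  unfold columnSum
  rw [← (Equiv.addRight w.2).tsum_eq
    (fun n : ℤ => (tent B (offset β (m + w.1, n) - (δ + offset β w)) : ℂ) * F (m + w.1, n))]
  refine tsum_congr fun n => ?_
  have h : ((m + w.1, n + w.2) : ℤ × ℤ) = (m, n) + w := rfl
  simp only [Equiv.coe_addRight, h, offset_add]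
  congr 3
  ring

theorem columnSum_nonneg (hF : ∀ v, 0 ≤ F v) (m : ℤ) : 0 ≤ columnSum β B δ F m := by
  rw [columnSum_eq_sum le_rfl]
  exact Finset.sum_nonneg fun n _ =>
    mul_nonneg (by exact_mod_cast tent_nonneg _ _) (hF _)

end Window

end DirectionalWeakMixing
end
noncomputable section
namespace DirectionalWeakMixing

local notation "⟪" x ", " y "⟫" => inner ℂ x y

variable {H : Type*} [NormedAddCommGroup H] [InnerProductSpace ℂ H]

/-! ### Positive operators with bounded trace -/

section Positive

open scoped ComplexOrder

/-- The Cauchy–Schwarz estimate for a positive operator. -/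
theorem norm_sq_apply_le_of_nonneg {K : H →L[ℂ] H} (hK : ∀ x, 0 ≤ ⟪K x, x⟫) (x : H) :
    ‖K x‖ ^ 2 ≤ ‖K‖ * (⟪K x, x⟫).re := by
  have hsymm : ∀ x y, ⟪K x, y⟫ = ⟪x, K y⟫ := by
    refine (LinearMap.isSymmetric_iff_inner_map_self_real (K : H →ₗ[ℂ] H)).2 fun v => ?_
    exact Complex.conj_eq_iff_im.2 (Complex.nonneg_iff.1 (hK v)).2.symm
  rcases (norm_nonneg K).eq_or_lt with h0 | h0
  · have : K = 0 := norm_eq_zero.1 h0.symm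
    simp [this]
  set t : ℝ := ‖K‖⁻¹
  have ht : t * ‖K‖ = 1 := inv_mul_cancel₀ h0.ne'
  have htpos : 0 < t := inv_pos.2 h0
  -- Positivity is tested at `x - t • K x`; the choice `t = ‖K‖⁻¹` lets the quadratic term absorb
  -- only half of the cross term.
  have h := (Complex.nonneg_iff.1 (hK (x - (t : ℂ) • K x))).1
  have h2 : (⟪K (K x), K x⟫).re ≤ ‖K‖ * ‖K x‖ ^ 2 := by
    refine (Complex.re_le_norm _).trans ((norm_inner_le_norm _ _).trans ?_)
    nlinarith [K.le_opNorm (K x), norm_nonneg (K x)]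
  have h3 : ⟪K x, K x⟫ = ((‖K x‖ ^ 2 : ℝ) : ℂ) := by
    rw [inner_self_eq_norm_sq_to_K]; push_cast; rfl
  have h4 : ⟪K (K x), x⟫ = ((‖K x‖ ^ 2 : ℝ) : ℂ) := by rw [hsymm, h3]
  simp only [map_sub, map_smul, inner_sub_left, inner_sub_right, inner_smul_left,
    inner_smul_right, h3, h4, Complex.conj_ofReal, Complex.sub_re, Complex.re_ofReal_mul,
    Complex.ofReal_re] at h
  have h5 : t * (t * (⟪K (K x), K x⟫).re) ≤ t * ‖K x‖ ^ 2 := by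
    refine mul_le_mul_of_nonneg_left ?_ htpos.le
    calc _ ≤ t * (‖K‖ * ‖K x‖ ^ 2) := mul_le_mul_of_nonneg_left h2 htpos.le
      _ = _ := by rw [← mul_assoc, ht, one_mul]
  have h6 : t * ‖K x‖ ^ 2 ≤ (⟪K x, x⟫).re := by linarith
  calc ‖K x‖ ^ 2 = ‖K‖ * (t * ‖K x‖ ^ 2) := by rw [← mul_assoc, mul_comm ‖K‖, ht, one_mul]
    _ ≤ _ := mul_le_mul_of_nonneg_left h6 h0.le

theorem orthonormal_fin_cons {n : ℕ} {e : Fin n → H} (he : Orthonormal ℂ e) {u : H}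
    (hu : ‖u‖ = 1) (hue : ∀ i, ⟪e i, u⟫ = 0) : Orthonormal ℂ (Fin.cons u e : Fin (n + 1) → H) := by
  refine ⟨fun i => ?_, fun i j hij => ?_⟩
  · refine Fin.cases ?_ (fun i => ?_) i
    · simpa using hu
    · simpa using he.1 i
  · induction i using Fin.cases with
    | zero =>
      induction j using Fin.cases with
      | zero => exact absurd rfl hij
      | succ j => simpa using inner_eq_zero_symm.1 (hue j)
    | succ i =>
      induction j using Fin.cases with
      | zero => simpa using hue i
      | succ j => simpa using he.2 (fun h => hij (by rw [h]))

/-- A positive operator with bounded trace maps balls to totally bounded sets. -/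
theorem totallyBounded_image_closedBall_of_trace_le {K : H →L[ℂ] H} (hK : ∀ x, 0 ≤ ⟪K x, x⟫)
    {C : ℝ} (hC : ∀ (n : ℕ) (e : Fin n → H), Orthonormal ℂ e → ∑ i, (⟪K (e i), e i⟫).re ≤ C)
    (r : ℝ) : TotallyBounded (K '' Metric.closedBall 0 r) := by
  refine totallyBounded_of_forall_approx fun ε hε => ?_
  obtain ⟨η, hη, hηε⟩ : ∃ η > 0, ‖K‖ * (η * r ^ 2) < ε ^ 2 := by
    refine ⟨ε ^ 2 / (‖K‖ * r ^ 2 + 1), by positivity, ?_⟩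
    rw [mul_left_comm, div_mul_eq_mul_div, div_lt_iff₀ (by positivity)]
    nlinarith [pow_pos hε 2]
  -- A maximal orthonormal family with diagonal entries at least `η` exists, since one of size `n`
  -- gives `n * η ≤ C`.
  obtain ⟨n, ⟨e, he, heη⟩, hmax⟩ : ∃ n : ℕ,
      (∃ e : Fin n → H, Orthonormal ℂ e ∧ ∀ i, η ≤ (⟪K (e i), e i⟫).re) ∧
      ¬ ∃ e : Fin (n + 1) → H, Orthonormal ℂ e ∧ ∀ i, η ≤ (⟪K (e i), e i⟫).re := by
    by_contra! hcon
    have hall : ∀ n : ℕ, ∃ e : Fin n → H, Orthonormal ℂ e ∧ ∀ i, η ≤ (⟪K (e i), e i⟫).re := by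
      intro n
      induction n with
      | zero => exact ⟨Fin.elim0, ⟨fun i => i.elim0, fun i => i.elim0⟩, fun i => i.elim0⟩
      | succ n ih => exact hcon n ih
    obtain ⟨n, hn⟩ := exists_nat_gt (C / η)
    obtain ⟨e, he, heη⟩ := hall n
    have h1 := hC n e he
    have h2 := Finset.card_nsmul_le_sum Finset.univ (fun i => (⟪K (e i), e i⟫).re) η
      fun i _ => heη i
    rw [div_lt_iff₀ hη] at hn
    simp only [Finset.card_univ, Fintype.card_fin, nsmul_eq_mul] at h2
    linarith
  set E := Submodule.span ℂ (Set.range e)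
  have hE : FiniteDimensional ℂ E := FiniteDimensional.span_of_finite ℂ (Set.finite_range e)
  -- Otherwise the normalised `z` could be added to the family. So `K` is small on `Eᗮ`, and `K` is
  -- close to its restriction to the finite-dimensional `E`.
  have hsmall : ∀ z ∈ Eᗮ, (⟪K z, z⟫).re ≤ η * ‖z‖ ^ 2 := by
    intro z hz
    by_contra! hlt
    have hz0 : z ≠ 0 := by rintro rfl; simp at hlt
    have hzn : 0 < ‖z‖ := norm_pos_iff.2 hz0
    refine hmax ⟨Fin.cons ((‖z‖⁻¹ : ℂ) • z) e, orthonormal_fin_cons he ?_ fun i => ?_, fun i => ?_⟩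
    · rw [norm_smul]; simp [hzn.ne']
    · rw [inner_smul_right, hz _ (Submodule.subset_span ⟨i, rfl⟩), mul_zero]
    · induction i using Fin.cases with
      | succ i => simpa using heη i
      | zero =>
        have : ⟪K ((‖z‖⁻¹ : ℂ) • z), (‖z‖⁻¹ : ℂ) • z⟫ = ((‖z‖⁻¹ * ‖z‖⁻¹ : ℝ) : ℂ) * ⟪K z, z⟫ := by
          rw [map_smul, inner_smul_left, inner_smul_right, ← Complex.ofReal_inv,
            Complex.conj_ofReal]
          push_cast; ring
        simp only [Fin.cons_zero]
        rw [this, Complex.re_ofReal_mul, ← mul_inv, ← sq, ← div_eq_inv_mul,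
          le_div_iff₀ (by positivity)]
        exact hlt.le
  have hcpt : IsCompact ((E.subtypeL : E → H) '' Metric.closedBall 0 r) :=
    (isCompact_closedBall (0 : E) r).image E.subtypeL.continuous
  refine ⟨_, (hcpt.image K.continuous).totallyBounded, ?_⟩
  rintro _ ⟨x, hx, rfl⟩
  obtain ⟨y, hy, z, hz, rfl⟩ := E.exists_add_mem_mem_orthogonal x
  have hpyth := norm_add_sq_eq_norm_sq_add_norm_sq_of_inner_eq_zero y z (hz y hy)
  have hxr : ‖y + z‖ ≤ r := by simpa using hx
  have hr : 0 ≤ r := (norm_nonneg _).trans hxr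
  have hyr : ‖y‖ ≤ r := by nlinarith [norm_nonneg y, norm_nonneg z, norm_nonneg (y + z)]
  have hzr : ‖z‖ ≤ r := by nlinarith [norm_nonneg y, norm_nonneg z, norm_nonneg (y + z)]
  refine ⟨K y, ⟨y, ⟨⟨y, hy⟩, by simpa using hyr, rfl⟩, rfl⟩, ?_⟩
  rw [dist_eq_norm, ← map_sub, add_sub_cancel_left]
  refine lt_of_pow_lt_pow_left₀ 2 hε.le ((norm_sq_apply_le_of_nonneg hK z).trans_lt ?_)
  refine lt_of_le_of_lt (mul_le_mul_of_nonneg_left ((hsmall z hz).trans ?_) (norm_nonneg K)) hηε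
  gcongr

end Positive

/-! ### Almost periodic vectors of isometric representations -/

/-- A representation of `ℤ²` by linear isometries. -/
structure IsometricRep (H : Type*) [NormedAddCommGroup H] [InnerProductSpace ℂ H] where
  /-- the isometry attached to a lattice point -/
  op : ℤ × ℤ → H →ₗᵢ[ℂ] H
  op_zero : ∀ x, op 0 x = x
  op_add : ∀ v w x, op (v + w) x = op v (op w x)

namespace IsometricRep

variable (U : IsometricRep H)

theorem op_comm (v w : ℤ × ℤ) (x : H) : U.op v (U.op w x) = U.op w (U.op v x) := by
  rw [← U.op_add, add_comm, U.op_add]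

theorem op_neg_apply (v : ℤ × ℤ) (x : H) : U.op v (U.op (-v) x) = x := by
  rw [← U.op_add, add_neg_cancel, U.op_zero]

theorem inner_op_right (v : ℤ × ℤ) (x y : H) : ⟪x, U.op v y⟫ = ⟪U.op (-v) x, y⟫ := by
  conv_lhs => rw [← U.op_neg_apply v x]
  exact (U.op v).inner_map_map _ _

/-- The orbit of `x` over a set of lattice points is totally bounded. -/
def AlmostPeriodic (S : Set (ℤ × ℤ)) (x : H) : Prop :=
  TotallyBounded ((fun v => U.op v x) '' S)

variable {U}

theorem AlmostPeriodic.op {S : Set (ℤ × ℤ)} {x : H} (h : U.AlmostPeriodic S x) (w : ℤ × ℤ) :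
    U.AlmostPeriodic S (U.op w x) := by
  have := TotallyBounded.image h (U.op w).isometry.uniformContinuous
  rw [Set.image_image] at this
  simpa only [AlmostPeriodic, U.op_comm w] using this

/-- Almost periodicity over a strip does not depend on its width. -/
theorem AlmostPeriodic.of_strip {β b c : ℝ} (hb : 0 < b) {x : H}
    (h : U.AlmostPeriodic (strip β b) x) : U.AlmostPeriodic (strip β c) x := by
  obtain ⟨F, hF⟩ := exists_finite_translates β hb c
  refine TotallyBounded.subset ?_
    ((totallyBounded_biUnion F.finite_toSet).2 fun w _ => h.op w)
  rintro _ ⟨v, hv, rfl⟩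
  obtain ⟨w, hw, hvw⟩ := hF v hv
  refine Set.mem_biUnion hw ⟨v - w, hvw, ?_⟩
  simp only [← U.op_add, sub_add_cancel]

theorem AlmostPeriodic.of_forall_approx {S : Set (ℤ × ℤ)} {x : H}
    (h : ∀ ε > 0, ∃ y, U.AlmostPeriodic S y ∧ ‖x - y‖ < ε) : U.AlmostPeriodic S x := by
  refine totallyBounded_of_forall_approx fun ε hε => ?_
  obtain ⟨y, hy, hxy⟩ := h ε hε
  refine ⟨_, hy, ?_⟩
  rintro _ ⟨v, hv, rfl⟩
  refine ⟨_, ⟨v, hv, rfl⟩, ?_⟩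
  rwa [(U.op v).dist_map, dist_eq_norm]

/-- Vectors which are weakly mixing along strips are orthogonal to the almost periodic ones. -/
theorem inner_eq_zero_of_tendsto_average {β b : ℝ} (hb : 0 < b)
    {f : H} (hf : ∀ g, Tendsto (fun k : ℕ => (1 / ((truncStrip β b k).card : ℝ)) *
      ∑ v ∈ truncStrip β b k, ‖⟪g, U.op v f⟫‖) atTop (𝓝 0)) {g : H}
    (hg : U.AlmostPeriodic (strip β b) g) : ⟪g, f⟫ = 0 := by
  rw [← norm_le_zero_iff]
  refine le_of_forall_pos_le_add fun ε hε => ?_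
  obtain ⟨s, hs, hcov⟩ := Metric.totallyBounded_iff.1 hg (ε / (‖f‖ + 1)) (by positivity)
  lift s to Finset H using hs
  have hlim : Tendsto (fun k : ℕ => (∑ y ∈ s, (1 / ((truncStrip β b k).card : ℝ)) *
      ∑ v ∈ truncStrip β b k, ‖⟪y, U.op v f⟫‖) + ε) atTop (𝓝 (0 + ε)) := by
    have := tendsto_finsetSum s fun y _ => hf y
    rw [Finset.sum_const_zero] at this
    exact this.add_const ε
  refine ge_of_tendsto hlim ?_
  filter_upwards [eventually_gt_atTop 0] with k hk
  have hn0 : (0 : ℝ) < (truncStrip β b k).card := by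
    exact_mod_cast truncStrip_card_pos hb hk
  have hpt : ∀ v ∈ truncStrip β b k, ‖⟪g, f⟫‖ ≤ (∑ y ∈ s, ‖⟪y, U.op v f⟫‖) + ε := by
    intro v hv
    have := hcov ⟨v, mem_strip_iff.2 (mem_truncStrip.1 hv).1, rfl⟩
    simp only [Set.mem_iUnion, Metric.mem_ball, Finset.mem_coe] at this
    obtain ⟨y, hy, hd⟩ := this
    rw [dist_eq_norm, lt_div_iff₀ (by positivity)] at hd
    have h1 : ⟪g, f⟫ = ⟪y, U.op v f⟫ + ⟪U.op v g - y, U.op v f⟫ := by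
      rw [inner_sub_left, (U.op v).inner_map_map]; ring
    have h2 := norm_inner_le_norm (𝕜 := ℂ) (U.op v g - y) (U.op v f)
    rw [(U.op v).norm_map] at h2
    have h3 := Finset.single_le_sum (f := fun y => ‖⟪y, U.op v f⟫‖)
      (fun y _ => norm_nonneg _) hy
    rw [h1]
    refine (norm_add_le _ _).trans (add_le_add h3 (h2.trans ?_))
    nlinarith [norm_nonneg (U.op v g - y)]
  have hsum := Finset.sum_le_sum hpt
  rw [Finset.sum_const, nsmul_eq_mul, Finset.sum_add_distrib, Finset.sum_const, nsmul_eq_mul,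
    Finset.sum_comm] at hsum
  rw [← Finset.mul_sum, one_div]
  refine le_of_mul_le_mul_left ?_ hn0
  rw [mul_add, mul_inv_cancel_left₀ hn0.ne']
  exact hsum

variable (U)

/-! ### Mean operators and their almost periodic values -/

/-- The product of matrix coefficients attached to a lattice point. -/
def coeff (f x y : H) (v : ℤ × ℤ) : ℂ := ⟪x, U.op v f⟫ * ⟪U.op v f, y⟫

theorem norm_coeff_le (f x y : H) (v : ℤ × ℤ) : ‖U.coeff f x y v‖ ≤ ‖f‖ ^ 2 * ‖x‖ * ‖y‖ := by
  rw [coeff, norm_mul]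
  have h1 := norm_inner_le_norm (𝕜 := ℂ) x (U.op v f)
  have h2 := norm_inner_le_norm (𝕜 := ℂ) (U.op v f) y
  rw [(U.op v).norm_map] at h1 h2
  calc _ ≤ (‖x‖ * ‖f‖) * (‖f‖ * ‖y‖) := mul_le_mul h1 h2 (norm_nonneg _) (by positivity)
    _ = _ := by ring

theorem coeff_self (f x : H) (v : ℤ × ℤ) :
    U.coeff f x x v = ((‖⟪x, U.op v f⟫‖ ^ 2 : ℝ) : ℂ) := by
  rw [coeff, ← inner_conj_symm (U.op v f) x, Complex.mul_conj, Complex.normSq_eq_norm_sq]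

theorem coeff_op (f x y : H) (v w : ℤ × ℤ) :
    U.coeff f (U.op w x) (U.op w y) (v + w) = U.coeff f x y v := by
  rw [coeff, add_comm, U.op_add, (U.op w).inner_map_map, (U.op w).inner_map_map, coeff]

variable {U} {β B : ℝ} {f : H} {𝒰 : Ultrafilter ℕ}

/-- A bound for the weighted column sums of coefficients, uniform for `|δ| ≤ D`. -/
theorem norm_columnSum_coeff_le (hB : 0 ≤ B) {δ D : ℝ} (hδ : |δ| ≤ D) (f x y : H) (m : ℤ) :
    ‖columnSum β B δ (U.coeff f x y) m‖ ≤ (2 * (B + D) + 1) * (B * (‖f‖ ^ 2 * ‖x‖ * ‖y‖)) :=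
  norm_columnSum_le hB hδ (U.norm_coeff_le f x y) m

/-- The tent of half-width `b / 2 + 1` is at least `1` on the strip of width `b`, and all terms are
nonnegative. -/
theorem sum_truncStrip_le (b : ℝ) (f g : H) (k : ℕ) :
    ∑ v ∈ truncStrip β b k, ‖⟪g, U.op v f⟫‖ ^ 2 ≤
      k * ‖cesaro (columnSum β (b / 2 + 1) 0 (U.coeff f g g)) k‖ := by
  rcases Nat.eq_zero_or_pos k with rfl | hk
  · have : truncStrip β b 0 = ∅ := Finset.eq_empty_of_forall_notMem fun v hv => by
      have := mem_truncStrip.1 hv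
      omega
    simp [this]
  set a : ℤ × ℤ → ℝ := fun v => ‖⟪g, U.op v f⟫‖ ^ 2
  set G : (Σ _ : ℕ, ℤ) → ℝ := fun p =>
    tent (b / 2 + 1) (offset β (p.1, p.2)) * a (p.1, p.2)
  have hG : ∀ p, 0 ≤ G p := fun p => mul_nonneg (tent_nonneg _ _) (sq_nonneg _)
  have hces : k * ‖cesaro (columnSum β (b / 2 + 1) 0 (U.coeff f g g)) k‖ =
      ∑ p ∈ (Finset.range k).sigma fun m => columnSupport β (b / 2 + 1 + 0) m, G p := by
    rw [cesaro, norm_mul, norm_inv, Complex.norm_natCast,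
      mul_inv_cancel_left₀ (by positivity), Finset.sum_sigma]
    have : ∑ m ∈ Finset.range k, columnSum β (b / 2 + 1) 0 (U.coeff f g g) m =
        ((∑ m ∈ Finset.range k, ∑ n ∈ columnSupport β (b / 2 + 1 + 0) m, G ⟨m, n⟩ : ℝ) : ℂ) := by
      push_cast
      refine Finset.sum_congr rfl fun m _ => ?_
      rw [columnSum_eq_sum abs_zero.le]
      refine Finset.sum_congr rfl fun n _ => ?_
      rw [coeff_self, sub_zero]
      simp only [G, a]
      push_cast
      rfl
    rw [this, Complex.norm_real, Real.norm_of_nonneg]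
    exact Finset.sum_nonneg fun m _ => Finset.sum_nonneg fun n _ => hG _
  rw [hces]
  have hinj : Set.InjOn (fun v : ℤ × ℤ => (⟨v.1.toNat, v.2⟩ : Σ _ : ℕ, ℤ))
      (truncStrip β b k) := by
    intro v hv w hw h
    have hv' := mem_truncStrip.1 hv
    have hw' := mem_truncStrip.1 hw
    simp only [Sigma.mk.injEq, heq_eq_eq] at h
    exact Prod.ext (by omega) h.2
  have hcast : ∀ v ∈ truncStrip β b k, ((v.1.toNat : ℤ), v.2) = v := fun v hv =>
    Prod.ext (Int.toNat_of_nonneg (mem_truncStrip.1 hv).2.1) rfl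
  calc ∑ v ∈ truncStrip β b k, a v
      ≤ ∑ v ∈ truncStrip β b k, G ⟨v.1.toNat, v.2⟩ := Finset.sum_le_sum fun v hv => by
        have h1 : 1 ≤ tent (b / 2 + 1) (offset β v) :=
          le_max_of_le_right (by linarith [(mem_truncStrip.1 hv).1])
        simp only [G, hcast v hv]
        exact le_mul_of_one_le_left (sq_nonneg _) h1
    _ = ∑ p ∈ (truncStrip β b k).image fun v => (⟨v.1.toNat, v.2⟩ : Σ _ : ℕ, ℤ), G p :=
        (Finset.sum_image hinj).symm
    _ ≤ _ := by
        refine Finset.sum_le_sum_of_subset_of_nonneg (fun p hp => ?_) fun p _ _ => hG p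
        obtain ⟨v, hv, rfl⟩ := Finset.mem_image.1 hp
        have hv' := mem_truncStrip.1 hv
        refine Finset.mem_sigma.2 ⟨Finset.mem_range.2 (by dsimp only; omega),
          mem_columnSupport.2 ?_⟩
        simp only [hcast v hv]
        linarith

variable (U β)

/-- The ultrafilter mean of the sesquilinear forms `⟪x, U^v f⟫⟪U^v f, y⟫`, weighted around the
transverse coordinate `δ`. -/
def meanForm (hB : 0 ≤ B) (𝒰 : Ultrafilter ℕ) (f : H) (δ : ℝ) : H →L⋆[ℂ] H →L[ℂ] ℂ :=
  LinearMap.mkContinuous₂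
    (LinearMap.mk₂'ₛₗ (starRingEnd ℂ) (RingHom.id ℂ)
      (fun x y => ultraMean 𝒰 (columnSum β B δ (U.coeff f x y)))
      (fun x x' y => by
        rw [← ultraMean_add (norm_columnSum_coeff_le hB le_rfl f x y)
          (norm_columnSum_coeff_le hB le_rfl f x' y)]
        congr 1; ext m; rw [← columnSum_add]; congr 1; ext v
        simp only [coeff, inner_add_left]; ring)
      (fun z x y => by
        rw [smul_eq_mul, ← ultraMean_const_mul _ (norm_columnSum_coeff_le hB le_rfl f x y)]
        congr 1; ext m; rw [← columnSum_const_mul]; congr 1; ext v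
        simp only [coeff, inner_smul_left]; ring)
      (fun x y y' => by
        rw [← ultraMean_add (norm_columnSum_coeff_le hB le_rfl f x y)
          (norm_columnSum_coeff_le hB le_rfl f x y')]
        congr 1; ext m; rw [← columnSum_add]; congr 1; ext v
        simp only [coeff, inner_add_right]; ring)
      (fun z x y => by
        rw [RingHom.id_apply, smul_eq_mul,
          ← ultraMean_const_mul _ (norm_columnSum_coeff_le hB le_rfl f x y)]
        congr 1; ext m; rw [← columnSum_const_mul]; congr 1; ext v
        simp only [coeff, inner_smul_right]; ring))
    ((2 * (B + |δ|) + 1) * (B * ‖f‖ ^ 2))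
    (fun x y => by
      refine (norm_ultraMean_le (norm_columnSum_coeff_le hB le_rfl f x y)).trans_eq ?_
      ring)

variable [CompleteSpace H]

/-- The operator representing `meanForm`. -/
def meanOp (hB : 0 ≤ B) (𝒰 : Ultrafilter ℕ) (f : H) (δ : ℝ) : H →L[ℂ] H :=
  InnerProductSpace.continuousLinearMapOfBilin (U.meanForm β hB 𝒰 f δ)

theorem inner_meanOp (hB : 0 ≤ B) (𝒰 : Ultrafilter ℕ) (f : H) (δ : ℝ) (x y : H) :
    ⟪U.meanOp β hB 𝒰 f δ x, y⟫ = ultraMean 𝒰 (columnSum β B δ (U.coeff f x y)) :=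
  InnerProductSpace.continuousLinearMapOfBilin_apply _ _ _

theorem norm_meanOp_sub_le (hB : 0 ≤ B) {δ δ' D : ℝ} (hδ : |δ| ≤ D) (hδ' : |δ'| ≤ D) (x : H) :
    ‖U.meanOp β hB 𝒰 f δ x - U.meanOp β hB 𝒰 f δ' x‖ ≤
      (2 * (B + D) + 1) * ‖f‖ ^ 2 * |δ - δ'| * ‖x‖ := by
  set z := U.meanOp β hB 𝒰 f δ x - U.meanOp β hB 𝒰 f δ' x with hz
  rcases (norm_nonneg z).eq_or_lt with h0 | h0
  · rw [← h0]
    have hD : 0 ≤ D := (abs_nonneg _).trans hδ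
    positivity
  refine le_of_mul_le_mul_right ?_ h0
  have h1 : ‖z‖ * ‖z‖ = ‖⟪z, z⟫‖ := by rw [← sq]; simp [inner_self_eq_norm_sq_to_K]
  rw [h1]
  conv_lhs => rw [hz]
  rw [inner_sub_left, inner_meanOp, inner_meanOp]
  refine (norm_ultraMean_sub_le (norm_columnSum_coeff_le hB le_rfl f x z)
    (norm_columnSum_coeff_le hB le_rfl f x z)
    (norm_columnSum_sub_le hB hδ hδ' (U.norm_coeff_le f x z))).trans_eq ?_
  ring

open scoped ComplexOrder in
theorem inner_meanOp_self_nonneg (hB : 0 ≤ B) (δ : ℝ) (x : H) :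
    0 ≤ ⟪U.meanOp β hB 𝒰 f δ x, x⟫ := by
  rw [inner_meanOp]
  refine ge_of_tendsto (tendsto_ultraMean 𝒰 (norm_columnSum_coeff_le hB le_rfl f x x))
    (Eventually.of_forall fun k => ?_)
  have hk : (0 : ℂ) ≤ (k : ℂ)⁻¹ := by
    rw [← Complex.ofReal_natCast, ← Complex.ofReal_inv]
    exact_mod_cast inv_nonneg.2 (Nat.cast_nonneg' (α := ℝ) k)
  refine mul_nonneg hk (Finset.sum_nonneg fun m _ => ?_)
  refine columnSum_nonneg (fun v => ?_) _
  rw [coeff_self]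
  exact_mod_cast sq_nonneg ‖⟪x, U.op v f⟫‖

/-- Bessel's inequality bounds the trace of each rank-one term by `‖f‖ ^ 2`, and the bound passes to
weighted averages and limits. -/
theorem sum_inner_meanOp_le (hB : 0 ≤ B) (δ : ℝ) {n : ℕ} {e : Fin n → H} (he : Orthonormal ℂ e) :
    ∑ i, (⟪U.meanOp β hB 𝒰 f δ (e i), e i⟫).re ≤ (2 * (B + |δ|) + 1) * (B * ‖f‖ ^ 2) := by
  rw [← Complex.re_sum]
  refine (Complex.re_le_norm _).trans ?_
  simp only [inner_meanOp]
  have hlim := tendsto_finsetSum Finset.univ fun i _ =>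
    tendsto_ultraMean 𝒰 (norm_columnSum_coeff_le (U := U) (β := β) hB (le_refl |δ|) f (e i) (e i))
  refine le_of_tendsto hlim.norm (Eventually.of_forall fun k => ?_)
  have hsum : ∀ v, ‖∑ i, U.coeff f (e i) (e i) v‖ ≤ ‖f‖ ^ 2 := fun v => by
    simp only [coeff_self]
    rw [← Complex.ofReal_sum, Complex.norm_real, Real.norm_of_nonneg (by positivity)]
    refine (he.sum_inner_products_le (U.op v f)).trans_eq ?_
    rw [(U.op v).norm_map]
  have heq : ∑ i, cesaro (columnSum β B δ (U.coeff f (e i) (e i))) k =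
      cesaro (columnSum β B δ fun v => ∑ i, U.coeff f (e i) (e i) v) k := by
    simp only [cesaro, ← Finset.mul_sum]
    rw [Finset.sum_comm]
    congr 1
    refine Finset.sum_congr rfl fun m _ => ?_
    simp only [columnSum_eq_sum (le_refl |δ|), Finset.mul_sum]
    exact Finset.sum_comm
  rw [heq]
  exact norm_cesaro_le (norm_columnSum_le hB le_rfl hsum) k

theorem totallyBounded_meanOp_image (hB : 0 ≤ B) (δ r : ℝ) :
    TotallyBounded (U.meanOp β hB 𝒰 f δ '' Metric.closedBall 0 r) :=
  totallyBounded_image_closedBall_of_trace_le (U.inner_meanOp_self_nonneg β hB δ)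
    (fun _ _ he => U.sum_inner_meanOp_le β hB δ he) r

/-- Translating the coefficients by `w` shifts the columns, which the mean ignores, and recentres
the tent. -/
theorem op_meanOp (h𝒰 : (𝒰 : Filter ℕ) ≤ atTop) (hB : 0 ≤ B) (δ : ℝ) (w : ℤ × ℤ) (x : H) :
    U.op w (U.meanOp β hB 𝒰 f δ x) = U.meanOp β hB 𝒰 f (δ + offset β w) (U.op w x) := by
  refine ext_inner_right ℂ fun y => ?_
  rw [← U.op_neg_apply w y]
  generalize U.op (-w) y = y
  rw [(U.op w).inner_map_map, inner_meanOp, inner_meanOp,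
    ← ultraMean_shift h𝒰 (norm_columnSum_coeff_le (δ := δ + offset β w) hB le_rfl f
      (U.op w x) (U.op w y)) w.1]
  congr 1
  ext m
  rw [← columnSum_shift]
  simp only [coeff_op]

/-- The values of the mean operators are almost periodic over strips. -/
theorem almostPeriodic_meanOp (h𝒰 : (𝒰 : Filter ℕ) ≤ atTop) (hB : 0 ≤ B) (c : ℝ) (x : H) :
    U.AlmostPeriodic (strip β c) (U.meanOp β hB 𝒰 f 0 x) := by
  refine totallyBounded_of_forall_approx fun ε hε => ?_
  set D := c / 2
  -- The sign of `c` is arbitrary here; for negative `c` the strip is empty.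
  rcases lt_or_ge D 0 with hD | hD
  · refine ⟨∅, totallyBounded_empty, ?_⟩
    rintro _ ⟨v, hv, rfl⟩
    exact absurd (mem_strip_iff.1 hv) (not_le.2 (hD.trans_le (abs_nonneg _)))
  set A := (2 * (B + D) + 1) * ‖f‖ ^ 2
  have hA : 0 ≤ A := by positivity
  have hη : 0 < ε / (A * ‖x‖ + 1) := by positivity
  obtain ⟨t, ht, htfin, hcov⟩ := Metric.finite_approx_of_totallyBounded
    (isCompact_Icc (a := -D) (b := D)).totallyBounded _ hη
  -- The orbit point is `K_{offset v} (U^v x)`, with `U^v x` in a fixed ball; replacing `offset v`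
  -- by a nearby `δ` of the net costs less than `ε`.
  refine ⟨⋃ δ ∈ t, U.meanOp β hB 𝒰 f δ '' Metric.closedBall 0 ‖x‖,
    (totallyBounded_biUnion htfin).2 fun δ _ => U.totallyBounded_meanOp_image β hB δ _, ?_⟩
  rintro _ ⟨v, hv, rfl⟩
  have hv' : |offset β v| ≤ D := mem_strip_iff.1 hv
  have := hcov (abs_le.1 hv')
  simp only [Set.mem_iUnion, Metric.mem_ball] at this
  obtain ⟨δ, hδ, hdist⟩ := this
  refine ⟨_, Set.mem_biUnion hδ ⟨U.op v x, by simp, rfl⟩, ?_⟩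
  simp only [U.op_meanOp β h𝒰 hB, zero_add]
  rw [dist_eq_norm]
  refine (U.norm_meanOp_sub_le β hB hv' (abs_le.2 (ht hδ)) _).trans_lt ?_
  rw [(U.op v).norm_map]
  rw [Real.dist_eq, lt_div_iff₀ (by positivity)] at hdist
  change A * _ * _ < _
  nlinarith [abs_nonneg (offset β v - δ)]

variable {U β}

/-- With `g = K_0 x`, the number `⟪K_0 x, g⟫` is a mean of terms containing the factor `⟪U^v f, g⟫`,
which vanishes because `g` and its translates are almost periodic. -/
theorem meanOp_eq_zero {c : ℝ} (hf : ∀ g, U.AlmostPeriodic (strip β c) g → ⟪g, f⟫ = 0)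
    (h𝒰 : (𝒰 : Filter ℕ) ≤ atTop) (hB : 0 ≤ B) (x : H) : U.meanOp β hB 𝒰 f 0 x = 0 := by
  set g := U.meanOp β hB 𝒰 f 0 x with hg
  have hap : U.AlmostPeriodic (strip β c) g := U.almostPeriodic_meanOp β h𝒰 hB c x
  have hz : ∀ v, ⟪U.op v f, g⟫ = 0 := fun v => by
    rw [inner_eq_zero_symm, U.inner_op_right]
    exact hf _ (hap.op _)
  rw [← inner_self_eq_zero (𝕜 := ℂ)]
  conv_lhs => rw [hg]
  rw [inner_meanOp]
  have h0 : columnSum β B 0 (U.coeff f x g) = fun _ => 0 := by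
    ext m
    rw [columnSum_eq_sum le_rfl]
    exact Finset.sum_eq_zero fun n _ => by rw [coeff, hz, mul_zero, mul_zero]
  rw [h0]
  exact norm_le_zero_iff.1 (norm_ultraMean_le fun m => norm_zero.le)

theorem tendsto_cesaro_coeff {c : ℝ} (hf : ∀ g, U.AlmostPeriodic (strip β c) g → ⟪g, f⟫ = 0)
    (hB : 0 ≤ B) (g : H) : Tendsto (cesaro (columnSum β B 0 (U.coeff f g g))) atTop (𝓝 0) := by
  rw [tendsto_iff_ultrafilter]
  intro 𝒰 h𝒰
  have := tendsto_ultraMean 𝒰 (norm_columnSum_coeff_le (U := U) (β := β) hB abs_zero.le f g g)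
  rwa [← U.inner_meanOp β hB, meanOp_eq_zero hf h𝒰 hB, inner_zero_left] at this

/-- Vectors orthogonal to the almost periodic ones are weakly mixing along strips. -/
theorem tendsto_average_of_forall_inner_eq_zero {b c : ℝ} (hb : 0 < b)
    (hf : ∀ g, U.AlmostPeriodic (strip β c) g → ⟪g, f⟫ = 0) (g : H) :
    Tendsto (fun k : ℕ => (1 / ((truncStrip β b k).card : ℝ)) *
      ∑ v ∈ truncStrip β b k, ‖⟪g, U.op v f⟫‖) atTop (𝓝 0) := by
  obtain ⟨N, C, hNC⟩ := exists_le_mul_card_truncStrip β hb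
  have hB : 0 ≤ b / 2 + 1 := by positivity
  have hlim := ((tendsto_cesaro_coeff hf hB g).norm.const_mul ((N + C : ℕ) : ℝ)).sqrt
  rw [norm_zero, mul_zero, Real.sqrt_zero] at hlim
  refine squeeze_zero' (Eventually.of_forall fun k => by positivity) ?_ hlim
  filter_upwards [eventually_gt_atTop 0] with k hk
  have hpos : 0 < (truncStrip β b k).card := truncStrip_card_pos hb hk
  set n := (truncStrip β b k).card with hn
  have hn0 : (0 : ℝ) < n := by exact_mod_cast hpos
  refine Real.le_sqrt_of_sq_le ?_
  have h1 := sq_sum_le_card_mul_sum_sq (s := truncStrip β b k) (f := fun v => ‖⟪g, U.op v f⟫‖)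
  have h2 := sum_truncStrip_le (U := U) (β := β) b f g k
  set r := ‖cesaro (columnSum β (b / 2 + 1) 0 (U.coeff f g g)) k‖
  have hr : 0 ≤ r := norm_nonneg _
  -- The additive constant `C` is absorbed because `n ≥ 1`.
  have h3 : (k : ℝ) ≤ (N + C : ℕ) * n := by
    have : k ≤ (N + C) * n := by nlinarith [hNC k]
    exact_mod_cast this
  rw [← hn] at h1
  rw [mul_pow, one_div, inv_pow, inv_mul_le_iff₀ (by positivity)]
  calc _ ≤ (n : ℝ) * ∑ v ∈ truncStrip β b k, ‖⟪g, U.op v f⟫‖ ^ 2 := h1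
    _ ≤ n * (k * r) := by gcongr
    _ ≤ n * (((N + C : ℕ) * n) * r) := by gcongr
    _ = _ := by ring

end IsometricRep

end DirectionalWeakMixing
end
noncomputable section
namespace DirectionalWeakMixing

variable {X : Type*} [MeasurableSpace X] {μ : Measure X}

/-! ### Almost periodic functions and the Kronecker algebra -/

/-- The Koopman representation of a measure-preserving action on `L²`. -/
def koopmanRep (T : MPAction μ) : IsometricRep (Lp ℂ 2 μ) where
  op v := Lp.compMeasurePreservingₗᵢ ℂ (T.toFun v) (T.measurePreserving v)
  op_zero f := by
    refine Lp.ext ((Lp.coeFn_compMeasurePreserving f (T.measurePreserving 0)).trans ?_)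
    exact Eventually.of_forall fun x => congrArg f (T.map_zero x)
  op_add v w f := by
    refine Lp.ext ((Lp.coeFn_compMeasurePreserving f (T.measurePreserving (v + w))).trans ?_)
    have h1 := Lp.coeFn_compMeasurePreserving
      (Lp.compMeasurePreserving (T.toFun w) (T.measurePreserving w) f) (T.measurePreserving v)
    have h2 := (T.measurePreserving v).quasiMeasurePreserving.ae_eq_comp
      (Lp.coeFn_compMeasurePreserving f (T.measurePreserving w))
    refine EventuallyEq.trans ?_ (h1.trans h2).symm
    refine Eventually.of_forall fun x => ?_
    simp only [Function.comp_apply]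
    -- Composition reverses the order of the two transformations; commutativity of `ℤ²` restores it.
    rw [add_comm, T.map_add]

theorem koopmanRep_op (T : MPAction μ) (v : ℤ × ℤ) (f : Lp ℂ 2 μ) :
    (koopmanRep T).op v f = koopman T v f := rfl

theorem isKroneckerSet_iff_almostPeriodic [IsFiniteMeasure μ] {T : MPAction μ} {β c : ℝ}
    {B : Set X} : IsKroneckerSet T β c B ↔ ∃ hB : MeasurableSet B,
      (koopmanRep T).AlmostPeriodic (strip β c)
        (indicatorConstLp 2 hB (measure_ne_top μ B) (1 : ℂ)) :=
  exists_congr fun _ => ⟨fun h => h.totallyBounded.subset subset_closure,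
    fun h => (TotallyBounded.closure h).isCompact_of_isClosed isClosed_closure⟩

/-- Lipschitz functions of almost periodic functions are almost periodic. -/
theorem almostPeriodic_compLp {T : MPAction μ} {S : Set (ℤ × ℤ)} {f : Lp ℂ 2 μ}
    (hf : (koopmanRep T).AlmostPeriodic S f) {φ : ℂ → ℂ} {K : NNReal} (hφ : LipschitzWith K φ)
    (h0 : φ 0 = 0) : (koopmanRep T).AlmostPeriodic S (hφ.compLp h0 f) := by
  have h := TotallyBounded.image hf (hφ.lipschitzWith_compLp h0 (p := 2) (μ := μ)).uniformContinuous
  rw [Set.image_image] at h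
  have himage : ∀ v, hφ.compLp h0 ((koopmanRep T).op v f) =
      (koopmanRep T).op v (hφ.compLp h0 f) := fun v => Eq.symm <| by
    refine Lp.ext ((Lp.coeFn_compMeasurePreserving _ (T.measurePreserving v)).trans ?_)
    refine EventuallyEq.trans ?_ (hφ.coeFn_compLp h0 _).symm
    refine ((T.measurePreserving v).quasiMeasurePreserving.ae_eq_comp
      (hφ.coeFn_compLp h0 f)).trans ?_
    exact ((Lp.coeFn_compMeasurePreserving f (T.measurePreserving v)).fun_comp φ).symm
  simpa only [IsometricRep.AlmostPeriodic, himage] using h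

variable [IsProbabilityMeasure μ] {T : MPAction μ} {β c : ℝ} {f : Lp ℂ 2 μ}

/-- The indicator of `O` is the limit of the Lipschitz functions `min 1 (n * d z)`, with `d` the
distance to the complement of `O`. They vanish at `0` because `0 ∉ O`, as composition in `Lp`
requires. -/
theorem isKroneckerSet_preimage_of_zero_notMem
    (hf : (koopmanRep T).AlmostPeriodic (strip β c) f) {O : Set ℂ} (hO : IsOpen O)
    (h0 : (0 : ℂ) ∉ O) : IsKroneckerSet T β c (f ⁻¹' O) := by
  have hfm : Measurable f := (Lp.stronglyMeasurable f).measurable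
  have hm : MeasurableSet (f ⁻¹' O) := hfm hO.measurableSet
  refine isKroneckerSet_iff_almostPeriodic.2 ⟨hm, ?_⟩
  set d : ℂ → ℝ := fun z => Metric.infDist z Oᶜ
  have hd : Continuous d := Metric.continuous_infDist_pt _
  have hdpos : ∀ z ∈ O, 0 < d z := fun z hz => by
    refine (hO.isClosed_compl.notMem_iff_infDist_pos ⟨0, h0⟩).1 ?_
    exact fun h => h hz
  have hdzero : ∀ z ∉ O, d z = 0 := fun z hz => Metric.infDist_zero_of_mem hz
  -- The set where the `n`-th Lipschitz function, composed with `f`, differs from the indicator; it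
  -- decreases to the empty set.
  set A : ℕ → Set X := fun n => f ⁻¹' (O ∩ {z | n * d z < 1})
  have hA : ∀ n, MeasurableSet (A n) := fun n =>
    hfm (hO.inter (isOpen_lt (continuous_const.mul hd) continuous_const)).measurableSet
  have hAanti : Antitone A := fun n n' hn x hx => by
    refine ⟨hx.1, lt_of_le_of_lt (b := n' * d (f x)) ?_ hx.2⟩
    exact mul_le_mul_of_nonneg_right (by exact_mod_cast hn) Metric.infDist_nonneg
  have hAempty : ⋂ n, A n = ∅ := by
    refine Set.eq_empty_of_forall_notMem fun x hx => ?_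
    rw [Set.mem_iInter] at hx
    obtain ⟨n, hn⟩ := exists_nat_gt (1 / d (f x))
    rw [div_lt_iff₀ (hdpos _ (hx 0).1)] at hn
    exact lt_asymm hn (hx n).2
  have hAlim : Tendsto (fun n => μ.real (A n)) atTop (𝓝 0) := by
    have := tendsto_measure_iInter_atTop (μ := μ) (fun n => (hA n).nullMeasurableSet) hAanti
      ⟨0, measure_ne_top _ _⟩
    rw [hAempty, measure_empty] at this
    exact (ENNReal.tendsto_toReal ENNReal.zero_ne_top).comp this
  refine IsometricRep.AlmostPeriodic.of_forall_approx fun ε hε => ?_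
  obtain ⟨n, hn⟩ := ((tendsto_order.1 hAlim).2 (ε ^ 2) (by positivity)).exists
  have hlip : LipschitzWith (1 * (1 * n)) fun z : ℂ => ((min 1 (n * d z) : ℝ) : ℂ) := by
    refine Complex.isometry_ofReal.lipschitz.comp (LipschitzWith.const_min ?_ 1)
    refine LipschitzWith.of_dist_le_mul fun x y => ?_
    rw [Real.dist_eq, ← mul_sub, abs_mul, Nat.abs_cast, one_mul]
    have := (Metric.lipschitz_infDist_pt Oᶜ).dist_le_mul x y
    rw [Real.dist_eq, NNReal.coe_one, one_mul] at this
    exact mul_le_mul_of_nonneg_left this (Nat.cast_nonneg n)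
  have hlip0 : (fun z : ℂ => ((min 1 (n * d z) : ℝ) : ℂ)) 0 = 0 := by
    simp [hdzero 0 h0]
  refine ⟨_, almostPeriodic_compLp hf hlip hlip0, ?_⟩
  have hle : ‖indicatorConstLp 2 hm (measure_ne_top μ _) (1 : ℂ) - hlip.compLp hlip0 f‖ ≤
      ‖indicatorConstLp 2 (hA n) (measure_ne_top μ _) (1 : ℂ)‖ := by
    refine Lp.norm_le_norm_of_ae_le ?_
    filter_upwards [Lp.coeFn_sub (indicatorConstLp 2 hm (measure_ne_top μ _) (1 : ℂ))
      (hlip.compLp hlip0 f), hlip.coeFn_compLp hlip0 f,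
      indicatorConstLp_coeFn (p := 2) (hs := hm) (hμs := measure_ne_top μ _) (c := (1 : ℂ)),
      indicatorConstLp_coeFn (p := 2) (hs := hA n) (hμs := measure_ne_top μ _) (c := (1 : ℂ))]
      with x h1 h2 h3 h4
    rw [h1, h4, Pi.sub_apply, h2, h3, Function.comp_apply]
    by_cases hx : f x ∈ O
    · rw [Set.indicator_of_mem (show x ∈ f ⁻¹' O from hx)]
      by_cases hxn : n * d (f x) < 1
      · rw [Set.indicator_of_mem (show x ∈ A n from ⟨hx, hxn⟩), min_eq_right hxn.le, norm_one,
          ← Complex.ofReal_one, ← Complex.ofReal_sub, Complex.norm_real, Real.norm_eq_abs]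
        have : 0 ≤ n * d (f x) := mul_nonneg (Nat.cast_nonneg n) Metric.infDist_nonneg
        exact abs_le.2 ⟨by linarith, by linarith⟩
      · rw [min_eq_left (not_lt.1 hxn)]
        simp
    · rw [Set.indicator_of_notMem (show x ∉ f ⁻¹' O from hx), hdzero _ hx]
      simp
  refine hle.trans_lt ?_
  rw [norm_indicatorConstLp (by simp) (by simp), norm_one, one_mul]
  refine lt_of_pow_lt_pow_left₀ 2 hε.le ?_
  rw [ENNReal.toReal_ofNat, ← Real.sqrt_eq_rpow, Real.sq_sqrt measureReal_nonneg]
  exact hn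

/-- Almost periodic functions are measurable with respect to the Kronecker algebra. -/
theorem measurable_kroneckerAlgebra_of_almostPeriodic
    (hf : (koopmanRep T).AlmostPeriodic (strip β c) f) :
    Measurable[kroneckerAlgebra T β c] (f : X → ℂ) := by
  refine @measurable_of_isOpen ℂ X _ _ _ (kroneckerAlgebra T β c) _ fun O hO => ?_
  change IsKroneckerSet T β c _
  by_cases h0 : (0 : ℂ) ∈ O
  · have h1 := isKroneckerSet_preimage_of_zero_notMem hf (hO.sdiff isClosed_singleton)
      (show (0 : ℂ) ∉ O \ {0} by simp)
    have h2 := isKroneckerSet_preimage_of_zero_notMem hf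
      (isClosed_singleton (x := (0 : ℂ))).isOpen_compl (by simp)
    -- When `0 ∈ O`, the preimage splits into that of `O \ {0}` and the zero set of `f`, the
    -- complement of a set already treated.
    convert h1.union h2.compl using 1
    ext x
    by_cases hx : f x = 0 <;> simp [hx, h0]
  · exact isKroneckerSet_preimage_of_zero_notMem hf hO h0

theorem inner_eq_zero_of_condExpL2_eq_zero {Y : Type*} {m m0 : MeasurableSpace Y} {ν : Measure Y}
    (hm : m ≤ m0) {f g : Lp ℂ 2 ν} (hg : g ∈ lpMeas ℂ ℂ m 2 ν) (hf : condExpL2 ℂ ℂ hm f = 0) :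
    inner ℂ g f = 0 := by
  have : Fact (m ≤ m0) := ⟨hm⟩
  exact Submodule.orthogonalProjectionOnto_eq_zero_iff.1 hf g hg

/-- The weak mixing functions are the orthogonal complement of the almost periodic ones. -/
theorem mem_weakMixingFunctions_iff : f ∈ weakMixingFunctions T β c ↔
    ∀ g, (koopmanRep T).AlmostPeriodic (strip β c) g → inner ℂ g f = 0 := by
  have hle := kroneckerAlgebra_le T β c
  constructor
  · intro hf g hg
    have hgm : g ∈ lpMeas ℂ ℂ (kroneckerAlgebra T β c) 2 μ :=
      mem_lpMeas_iff_aestronglyMeasurable.2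
        (measurable_kroneckerAlgebra_of_almostPeriodic hg).stronglyMeasurable.aestronglyMeasurable
    have h1 := (Lp.memLp f).condExpL2_ae_eq_condExp (𝕜 := ℂ) hle
    rw [Lp.toLp_coeFn] at h1
    have h2 : (condExpL2 ℂ ℂ hle f : Lp ℂ 2 μ) = 0 :=
      Lp.ext ((h1.trans hf).trans (Lp.coeFn_zero ℂ 2 μ).symm)
    exact inner_eq_zero_of_condExpL2_eq_zero hle hgm (Subtype.ext h2)
  · intro h
    refine (ae_eq_condExp_of_forall_setIntegral_eq hle
      ((Lp.memLp f).integrable (by norm_num)) (fun s _ _ => integrableOn_zero)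
      (fun s hs _ => ?_) aestronglyMeasurable_zero).symm
    obtain ⟨hsm, hap⟩ := isKroneckerSet_iff_almostPeriodic.1
      (show IsKroneckerSet T β c s from hs)
    rw [← L2.inner_indicatorConstLp_one hsm (measure_ne_top μ s), h _ hap]
    simp

end DirectionalWeakMixing
end

theorem theorem3p10 {X : Type*} [MeasurableSpace X] (μ : MeasureTheory.Measure X)
    [MeasureTheory.IsProbabilityMeasure μ] (T : DirectionalWeakMixing.MPAction μ) (β : ℝ)
    (b : ℝ) (hb : 0 < b) (c : ℝ) (hc : 0 < c) :
    DirectionalWeakMixing.weakMixingFunctions T β c =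
      {f : MeasureTheory.Lp ℂ 2 μ | ∀ g : MeasureTheory.Lp ℂ 2 μ,
        Filter.Tendsto
          (fun k : ℕ => (1 / ((DirectionalWeakMixing.truncStrip β b k).card : ℝ)) *
            ∑ v ∈ DirectionalWeakMixing.truncStrip β b k,
              ‖inner ℂ g (DirectionalWeakMixing.koopman T v f)‖)
          Filter.atTop (nhds 0)} := by
  ext f
  simp only [DirectionalWeakMixing.mem_weakMixingFunctions_iff, Set.mem_ofPred_eq,
    ← DirectionalWeakMixing.koopmanRep_op]
  constructor
  · intro hf g
    exact DirectionalWeakMixing.IsometricRep.tendsto_average_of_forall_inner_eq_zero hb hf g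
  · intro hf g hg
    -- Width independence transfers almost periodicity from width `c` to the averaging width `b`.
    exact DirectionalWeakMixing.IsometricRep.inner_eq_zero_of_tendsto_average hb hf (hg.of_strip hc)
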